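/- Let $2^{<\mathbb Z}=\{(x_i)_{i\in\mathbb Z}\in\{0,1\}^{\mathbb Z}:\exists n\in\mathbb N\ \forall i>n\ (x_i=0)\}$ be the Cantor bi-cube, endowed with the ultrametric $d\big((x_i),(y_i)\big)=\max_{i\in\mathbb Z}2^{i}|x_i-y_i|$. For a map $f:X\to Y$ between metric spaces and $\delta\ge 0$ put $\omega_f(\delta)=\sup\{\mathrm{dist}(f(x),f(x')):x,x'\in X,\ \mathrm{dist}(x,x')\le\delta\}\in[0,\infty]$. The map $f$ is *micro-uniform* if $\forall\varepsilon>0\ \exists\delta>0$ with $\omega_f(\delta)\le\varepsilon$, *macro-uniform* if $\forall\delta<\infty\ \exists\varepsilon<\infty$ with $\omega_f(\delta)\le\varepsilon$, and *bi-uniform* if it is both. Two metric spaces are *bi-uniformly equivalent* if there is a bijection $f$ between them such that $f$ and $f^{-1}$ are bi-uniform. For a metric space $X$, $s>0$ and $x\in X$ let $C_s(x)$ be the set of all $y\in X$ for which there is a finite chain $y=z_0,z_1,\dots,z_n=x$ in $X$ with $\mathrm{dist}(z_{i-1},z_i)\le s$ for all $i\le n$. The space $X$ has *bi-uniform dimension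 zero* if $\forall\varepsilon>0\ \exists\delta>0$ with $\sup_{x\in X}\mathrm{diam}\,C_\delta(x)\le\varepsilon$, and $\forall\delta\in(0,\infty)\ \exists\varepsilon<\infty$ with $\sup_{x\in X}\mathrm{diam}\,C_\delta(x)\le\varepsilon$. For $0<\delta\le\varepsilon<\infty$ put $\Theta^\varepsilon_\delta(X)=\sup_{x\in X}\big|\{C_\delta(y):y\in C_\varepsilon(x)\}\big|$. **Theorem (Universality of the Cantor bi-cube).** A metric space $X$ is bi-uniformly equivalent to a subspace of the Cantor bi-cube $2^{<\mathbb Z}$ if and only if $X$ has bi-uniform dimension zero and $\Theta^\varepsilon_\delta(X)<\infty$ for all $0<\delta\le\varepsilon<\infty$. -/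

import Mathlib

open scoped ENNReal Cardinal

noncomputable section

namespace BiUniform

/-- The oscillation `ω_f(δ) = sup {dist (f x) (f x') : dist x x' ≤ δ} ∈ [0, ∞]`. -/
def oscillation {X Y : Type*} [MetricSpace X] [MetricSpace Y] (f : X → Y) (δ : ℝ) : ℝ≥0∞ :=
  ⨆ (x : X) (x' : X) (_ : dist x x' ≤ δ), edist (f x) (f x')

/-- Micro-uniform (that is, uniformly continuous) maps. -/
def IsMicroUniform {X Y : Type*} [MetricSpace X] [MetricSpace Y] (f : X → Y) : Prop :=
  ∀ ε : ℝ, 0 < ε → ∃ δ : ℝ, 0 < δ ∧ oscillation f δ ≤ ENNReal.ofReal ε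

/-- Macro-uniform maps. -/
def IsMacroUniform {X Y : Type*} [MetricSpace X] [MetricSpace Y] (f : X → Y) : Prop :=
  ∀ δ : ℝ, 0 ≤ δ → ∃ ε : ℝ, 0 ≤ ε ∧ oscillation f δ ≤ ENNReal.ofReal ε

/-- Bi-uniform maps. -/
def IsBiUniform {X Y : Type*} [MetricSpace X] [MetricSpace Y] (f : X → Y) : Prop :=
  IsMacroUniform f ∧ IsMicroUniform f

/-- Two metric spaces are bi-uniformly equivalent if there is a bijection between them that is
bi-uniform together with its inverse. -/
def BiUniformlyEquivalent (X Y : Type*) [MetricSpace X] [MetricSpace Y] : Prop :=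
  ∃ f : X ≃ Y, IsBiUniform f ∧ IsBiUniform f.symm

/-- The `s`-connected component `C_s(x)`: all points that can be linked with `x` by a finite
chain whose consecutive points are at distance at most `s`. -/
def component {X : Type*} [MetricSpace X] (s : ℝ) (x : X) : Set X :=
  {y | Relation.ReflTransGen (fun a b : X => dist a b ≤ s) x y}

/-- The family `𝒞_s(X)` of all `s`-connected components. -/
def components (X : Type*) [MetricSpace X] (s : ℝ) : Set (Set X) :=
  Set.range (component s)

/-- The mesh of a family of sets: the supremum of the diameters of its members. -/
def mesh {X : Type*} [MetricSpace X] (𝒞 : Set (Set X)) : ℝ≥0∞ :=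
  ⨆ C ∈ 𝒞, Metric.ediam C

/-- Micro-uniform dimension zero. -/
def MicroUniformDimZero (X : Type*) [MetricSpace X] : Prop :=
  ∀ ε : ℝ, 0 < ε → ∃ δ : ℝ, 0 < δ ∧ mesh (components X δ) ≤ ENNReal.ofReal ε

/-- Macro-uniform (asymptotic) dimension zero. -/
def MacroUniformDimZero (X : Type*) [MetricSpace X] : Prop :=
  ∀ δ : ℝ, 0 < δ → ∃ ε : ℝ, 0 ≤ ε ∧ mesh (components X δ) ≤ ENNReal.ofReal ε

/-- Bi-uniform dimension zero. -/
def BiUniformDimZero (X : Type*) [MetricSpace X] : Prop :=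
  MicroUniformDimZero X ∧ MacroUniformDimZero X

/-- `Θ^ε_δ(X)`: the supremum over `x` of the cardinality of `{C_δ(y) : y ∈ C_ε(x)}`. The
supremum is over a family indexed by a type in the same universe, hence bounded above. -/
def bigTheta (X : Type*) [MetricSpace X] (δ ε : ℝ) : Cardinal :=
  ⨆ x : X, #(component δ '' component ε x)

/-- The underlying set of the Cantor bi-cube: the `0`-`1`-sequences indexed by the integers that
vanish at all large enough indices. -/
def CantorBiCube : Type :=
  {x : ℤ → Fin 2 // ∃ n : ℕ, ∀ i : ℤ, (n : ℤ) < i → x i = 0}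

namespace CantorBiCube

/-- The term `2 ^ i * |x_i - y_i|` of the metric. -/
def term (x y : CantorBiCube) (i : ℤ) : ℝ :=
  (2 : ℝ) ^ i * |((x.1 i : ℕ) : ℝ) - ((y.1 i : ℕ) : ℝ)|

theorem term_nonneg (x y : CantorBiCube) (i : ℤ) : 0 ≤ term x y i := by
  unfold term; positivity

theorem bddAbove_term (x y : CantorBiCube) : BddAbove (Set.range (term x y)) := by
  obtain ⟨n, hn⟩ := x.2
  obtain ⟨m, hm⟩ := y.2
  refine ⟨(2 : ℝ) ^ ((max n m : ℕ) : ℤ), ?_⟩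
  rintro _ ⟨i, rfl⟩
  unfold term
  by_cases hi : ((max n m : ℕ) : ℤ) < i
  · rw [hn i (by push_cast at hi; omega), hm i (by push_cast at hi; omega)]
    simp only [sub_self, abs_zero, mul_zero]
    positivity
  · have h1 : (2 : ℝ) ^ i ≤ (2 : ℝ) ^ ((max n m : ℕ) : ℤ) :=
      zpow_le_zpow_right₀ (by norm_num) (not_lt.mp hi)
    have h2 : |((x.1 i : ℕ) : ℝ) - ((y.1 i : ℕ) : ℝ)| ≤ 1 := by
      generalize x.1 i = a
      generalize y.1 i = b
      fin_cases a <;> fin_cases b <;> simp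
    calc _ ≤ (2 : ℝ) ^ i * 1 := by gcongr
      _ ≤ _ := by simpa using h1

/-- The metric `d(x, y) = max_i 2 ^ i * |x_i - y_i|` (the supremum is of a bounded family). -/
instance : MetricSpace CantorBiCube where
  dist x y := ⨆ i : ℤ, term x y i
  dist_self x := by simp [term]
  dist_comm x y := by
    refine congrArg iSup (funext fun i => ?_)
    simp only [term, abs_sub_comm]
  dist_triangle x y z := by
    refine ciSup_le fun i => ?_
    refine le_trans ?_ (add_le_add (le_ciSup (bddAbove_term x y) i)
      (le_ciSup (bddAbove_term y z) i))
    simp only [term, ← mul_add]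
    gcongr
    exact abs_sub_le _ _ _
  eq_of_dist_eq_zero := by
    intro x y h
    apply Subtype.ext
    funext i
    have h1 : term x y i ≤ 0 := (le_ciSup (bddAbove_term x y) i).trans h.le
    have h2 : term x y i = 0 := le_antisymm h1 (term_nonneg x y i)
    have h3 : (2 : ℝ) ^ i ≠ 0 := by positivity
    have h4 : ((x.1 i : ℕ) : ℝ) = ((y.1 i : ℕ) : ℝ) := by
      simpa [term, h3, sub_eq_zero] using h2
    exact Fin.ext (by exact_mod_cast h4)

end CantorBiCube

end BiUniform

end

open scoped ENNReal Cardinal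

namespace BiUniform

/-! ### Components, oscillation and counting. -/

section Basic

variable {X Y : Type*} [MetricSpace X] [MetricSpace Y]

/-! In a subspace of the bi-cube the strong triangle inequality keeps an `s`-chain within distance
`s` of its start. Pulling chains back through a bi-uniform equivalence gives dimension zero, and
finitely many digits separate the small components inside a large one. Conversely, the components of
`X` at scales `2 ^ k` form a tree indexed by the integers, and finiteness of `Θ` bounds its
branching at each level. Finitely many digits, placed in a block starting at `a k`, label the
branches at level `k`. In `exists_coding` a point is sent to the concatenation of its labels, so
balls of radius `2 ^ a k` correspond exactly to `2 ^ k`-components. Dimension zero is needed only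
for the inverse map. -/

theorem oscillation_le_ofReal_iff {f : X → Y} {δ ε : ℝ} (hε : 0 ≤ ε) :
    oscillation f δ ≤ ENNReal.ofReal ε ↔
      ∀ x x', dist x x' ≤ δ → dist (f x) (f x') ≤ ε := by
  simp only [oscillation, iSup_le_iff, edist_le_ofReal hε]

theorem mem_component_self (s : ℝ) (x : X) : x ∈ component s x :=
  Relation.ReflTransGen.refl

theorem mem_component_of_dist_le {s : ℝ} {x y : X} (h : dist x y ≤ s) : y ∈ component s x :=
  Relation.ReflTransGen.single h

theorem mem_component_symm {s : ℝ} {x y : X} (h : y ∈ component s x) : x ∈ component s y :=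
  have : Std.Symm (fun a b : X => dist a b ≤ s) := ⟨fun a b hab => by rwa [dist_comm]⟩
  Relation.ReflTransGen.stdSymm.symm _ _ h

theorem component_eq_iff {s : ℝ} {x y : X} :
    component s x = component s y ↔ y ∈ component s x := by
  refine ⟨fun h => h ▸ mem_component_self s y, fun h => ?_⟩
  ext z
  exact ⟨fun hz => (mem_component_symm h).trans hz, fun hz => Relation.ReflTransGen.trans h hz⟩

theorem component_mono {s t : ℝ} (hst : s ≤ t) (x : X) : component s x ⊆ component t x :=
  Relation.ReflTransGen.mono (fun _ _ h => le_trans h hst) x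

theorem component_eq_mono {s t : ℝ} (hst : s ≤ t) {x y : X}
    (h : component s x = component s y) : component t x = component t y :=
  component_eq_iff.2 (component_mono hst x (component_eq_iff.1 h))

theorem mesh_components_le_ofReal_iff {s ε : ℝ} (hε : 0 ≤ ε) :
    mesh (components X s) ≤ ENNReal.ofReal ε ↔
      ∀ x y : X, y ∈ component s x → dist x y ≤ ε := by
  simp only [mesh, components, iSup_le_iff, Set.forall_mem_range, Metric.ediam_le_iff,
    edist_le_ofReal hε]
  refine ⟨fun h x y hy => h x x (mem_component_self s x) y hy, fun h x y hy z hz => ?_⟩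
  exact h y z ((mem_component_symm hy).trans hz)

/-- Chains are mapped to chains. -/
theorem map_mem_component {f : X → Y} {s t : ℝ}
    (hf : ∀ x x', dist x x' ≤ s → dist (f x) (f x') ≤ t) {x y : X} (h : y ∈ component s x) :
    f y ∈ component t (f x) :=
  Relation.ReflTransGen.lift f (fun a b hab => hf a b hab) x y h

theorem bigTheta_lt_aleph0_iff {δ ε : ℝ} :
    bigTheta X δ ε < ℵ₀ ↔ ∃ n : ℕ, ∀ x : X, #(component δ '' component ε x) ≤ n := by
  constructor
  · intro h
    obtain ⟨n, hn⟩ := Cardinal.lt_aleph0.1 h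
    exact ⟨n, fun x => hn ▸ le_ciSup (f := fun x : X => #(component δ '' component ε x))
      Cardinal.bddAbove_of_small x⟩
  · rintro ⟨n, hn⟩
    exact (ciSup_le' hn).trans_lt (Cardinal.natCast_lt_aleph0)

end Basic

/-! ### Ultrametric structure of the bi-cube. -/

namespace CantorBiCube

theorem term_le_dist (x y : CantorBiCube) (i : ℤ) : term x y i ≤ dist x y :=
  le_ciSup (bddAbove_term x y) i

theorem term_eq_of_ne {x y : CantorBiCube} {i : ℤ} (h : x.1 i ≠ y.1 i) :
    term x y i = (2 : ℝ) ^ i := by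
  unfold term
  generalize x.1 i = a at *
  generalize y.1 i = b at *
  fin_cases a <;> fin_cases b <;> simp_all

theorem term_eq_of_eq {x y : CantorBiCube} {i : ℤ} (h : x.1 i = y.1 i) : term x y i = 0 := by
  simp [term, h]

theorem dist_lt_two_zpow_iff {x y : CantorBiCube} {m : ℤ} :
    dist x y < (2 : ℝ) ^ m ↔ ∀ i, m ≤ i → x.1 i = y.1 i := by
  constructor
  · intro h i hi
    by_contra hne
    have h1 := term_le_dist x y i
    rw [term_eq_of_ne hne] at h1
    exact absurd (h1.trans_lt h) (not_lt.2 (zpow_le_zpow_right₀ (by norm_num) hi))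
  · intro h
    -- A supremum of terms below `2 ^ m` need not be below it; the gap between consecutive powers of
    -- two restores strictness.
    have h1 : dist x y ≤ (2 : ℝ) ^ (m - 1) := by
      refine ciSup_le fun i => ?_
      by_cases hi : x.1 i = y.1 i
      · rw [term_eq_of_eq hi]; positivity
      · rw [term_eq_of_ne hi]
        refine zpow_le_zpow_right₀ (by norm_num) ?_
        by_contra hlt
        exact hi (h i (by omega))
    exact h1.trans_lt (zpow_lt_zpow_right₀ (by norm_num) (by omega))

theorem dist_le_max (x y z : CantorBiCube) : dist x z ≤ max (dist x y) (dist y z) := by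
  refine ciSup_le fun i => ?_
  by_cases hxz : x.1 i = z.1 i
  · rw [term_eq_of_eq hxz]; exact le_max_of_le_left dist_nonneg
  · rw [term_eq_of_ne hxz]
    by_cases hxy : x.1 i = y.1 i
    · exact le_max_of_le_right (term_eq_of_ne (hxy ▸ hxz) ▸ term_le_dist y z i)
    · exact le_max_of_le_left (term_eq_of_ne hxy ▸ term_le_dist x y i)

theorem dist_le_of_mem_component {S : Set CantorBiCube} {s : ℝ} (hs : 0 ≤ s) {x y : S}
    (h : y ∈ component s x) : dist x y ≤ s := by
  induction h with
  | refl => simpa using hs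
  | tail _ hbc ih => exact (dist_le_max _ _ _).trans (max_le ih hbc)

end CantorBiCube

theorem exists_two_zpow_le {ε : ℝ} (hε : 0 < ε) : ∃ k : ℤ, (2 : ℝ) ^ k ≤ ε :=
  let ⟨k, hk, _⟩ := exists_mem_Ico_zpow hε (one_lt_two : (1 : ℝ) < 2)
  ⟨k, hk⟩

theorem exists_lt_two_zpow (δ : ℝ) : ∃ k : ℤ, δ < (2 : ℝ) ^ k := by
  obtain ⟨n, hn⟩ := pow_unbounded_of_one_lt δ (one_lt_two : (1 : ℝ) < 2)
  exact ⟨n, by simpa using hn⟩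

/-! ### Necessity. -/

section Necessity

variable {X : Type*} [MetricSpace X] {S : Set CantorBiCube}

theorem dist_le_of_mem_component_of_maps {f : X ≃ S} {r s t : ℝ} (hs : 0 ≤ s)
    (hf : ∀ x x', dist x x' ≤ r → dist (f x) (f x') ≤ s)
    (hg : ∀ y y', dist y y' ≤ s → dist (f.symm y) (f.symm y') ≤ t) (x y : X)
    (h : y ∈ component r x) : dist x y ≤ t := by
  simpa using hg _ _ (CantorBiCube.dist_le_of_mem_component hs (map_mem_component hf h))

theorem biUniformDimZero_of_equiv {f : X ≃ S} (hf : IsBiUniform f) (hg : IsBiUniform f.symm) :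
    BiUniformDimZero X := by
  constructor
  · intro ε hε
    obtain ⟨η, hη, h1⟩ := hg.2 ε hε
    obtain ⟨δ, hδ, h2⟩ := hf.2 η hη
    rw [oscillation_le_ofReal_iff hε.le] at h1
    rw [oscillation_le_ofReal_iff hη.le] at h2
    exact ⟨δ, hδ, (mesh_components_le_ofReal_iff hε.le).2
      (dist_le_of_mem_component_of_maps hη.le h2 h1)⟩
  · intro δ hδ
    obtain ⟨η, hη, h2⟩ := hf.1 δ hδ.le
    obtain ⟨ε, hε, h1⟩ := hg.1 η hη
    rw [oscillation_le_ofReal_iff hε] at h1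
    rw [oscillation_le_ofReal_iff hη] at h2
    exact ⟨ε, hε, (mesh_components_le_ofReal_iff hε).2
      (dist_le_of_mem_component_of_maps hη h2 h1)⟩

/-- Images of points of one `ε`-component share all digits from `M` on. If the digits in `[m, M)`
also agree, the images are `θ`-close, so the points are `δ`-close. -/
theorem bigTheta_lt_aleph0_of_equiv {f : X ≃ S} (hf : IsBiUniform f) (hg : IsBiUniform f.symm)
    {δ ε : ℝ} (hδ : 0 < δ) (hε : 0 ≤ ε) : bigTheta X δ ε < ℵ₀ := by
  obtain ⟨η, hη, h2⟩ := hf.1 ε hε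
  obtain ⟨θ, hθ, h1⟩ := hg.2 δ hδ
  rw [oscillation_le_ofReal_iff hδ.le] at h1
  rw [oscillation_le_ofReal_iff hη] at h2
  obtain ⟨m, hm⟩ := exists_two_zpow_le hθ
  obtain ⟨M, hM⟩ := exists_lt_two_zpow η
  refine bigTheta_lt_aleph0_iff.2 ⟨Fintype.card (Finset.Ico m M → Fin 2), fun x => ?_⟩
  have key : ∀ c : component δ '' component ε x, ∃ y ∈ component ε x, component δ y = c :=
    fun c => c.2
  choose p hp hpc using key
  have hinj : Function.Injective
      (fun c (i : Finset.Ico m M) => ((f (p c)).1).1 (i : ℤ)) := by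
    intro c c' hcc
    apply Subtype.ext
    rw [← hpc c, ← hpc c', component_eq_iff]
    refine mem_component_of_dist_le ?_
    have hlt : dist (f (p c)).1 (f (p c')).1 < (2 : ℝ) ^ m := by
      refine CantorBiCube.dist_lt_two_zpow_iff.2 fun i hi => ?_
      by_cases hiM : i < M
      · exact congrFun hcc ⟨i, Finset.mem_Ico.2 ⟨hi, hiM⟩⟩
      · have hM' : ∀ c, dist (f x).1 (f (p c)).1 < (2 : ℝ) ^ M := fun c =>
          (CantorBiCube.dist_le_of_mem_component hη (map_mem_component h2 (hp c))).trans_lt hM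
        rw [← CantorBiCube.dist_lt_two_zpow_iff.1 (hM' c) i (not_lt.1 hiM),
          CantorBiCube.dist_lt_two_zpow_iff.1 (hM' c') i (not_lt.1 hiM)]
    simpa using h1 (f (p c)) (f (p c')) (hlt.le.trans hm)
  have : Finite (component δ '' component ε x) := Finite.of_injective _ hinj
  have := Fintype.ofFinite (component δ '' component ε x)
  rw [Cardinal.mk_fintype]
  exact_mod_cast Fintype.card_le_of_injective _ hinj

end Necessity

/-! ### Cutting the integers into blocks. -/

section Blocks

/-- A sequence with prescribed positive increments. -/
theorem exists_forall_add_one_eq_add (n : ℤ → ℕ) :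
    ∃ a : ℤ → ℤ, ∀ k, a (k + 1) = a k + n k := by
  -- Signed partial sums: at least one of the two intervals is empty.
  refine ⟨fun k => ∑ i ∈ Finset.Ico 0 k, (n i : ℤ) - ∑ i ∈ Finset.Ico k 0, (n i : ℤ),
    fun k => ?_⟩
  dsimp only
  rcases le_or_gt 0 k with hk | hk
  · rw [Finset.Ico_eq_empty_of_le (b := (0 : ℤ)) hk,
      Finset.Ico_eq_empty_of_le (b := (0 : ℤ)) (by omega : (0 : ℤ) ≤ k + 1),
      ← Finset.sum_Ico_add_eq_sum_Ico_add_one hk]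
    simp
  · rw [Finset.Ico_eq_empty_of_le (a := (0 : ℤ)) hk.le,
      Finset.Ico_eq_empty_of_le (a := (0 : ℤ)) (by omega : k + 1 ≤ 0),
      ← Finset.insert_Ico_add_one_left_eq_Ico hk, Finset.sum_insert (by simp)]
    simp

theorem le_sub_of_strictMono {a : ℤ → ℤ} (ha : StrictMono a) {k l : ℤ} (h : k ≤ l) :
    l - k ≤ a l - a k := by
  induction l, h using Int.leInduction with
  | base => simp
  | succ l _ ih =>
    have := ha (lt_add_one l)
    omega

/-- A strictly increasing sequence cuts the integers into blocks. -/
theorem exists_block {a : ℤ → ℤ} (ha : StrictMono a) (i : ℤ) : ∃ k, a k ≤ i ∧ i < a (k + 1) := by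
  obtain ⟨k, hk, hk'⟩ := Int.exists_greatest_of_bdd (P := fun k => a k ≤ i)
    ⟨max 0 (i - a 0), fun z hz => by
      by_contra hlt
      have := le_sub_of_strictMono ha (k := 0) (l := z) (by omega)
      omega⟩
    ⟨min 0 (i - a 0), by
      have := le_sub_of_strictMono ha (k := min 0 (i - a 0)) (l := 0) (by omega)
      omega⟩
  refine ⟨k, hk, ?_⟩
  by_contra hlt
  have := hk' (k + 1) (not_lt.1 hlt)
  omega

theorem exists_le_of_strictMono {a : ℤ → ℤ} (ha : StrictMono a) (b : ℤ) : ∃ k, a k ≤ b :=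
  (exists_block ha b).imp fun _ h => h.1

theorem exists_ge_of_strictMono {a : ℤ → ℤ} (ha : StrictMono a) (b : ℤ) : ∃ k, b ≤ a k :=
  let ⟨k, hk⟩ := exists_block ha b
  ⟨k + 1, hk.2.le⟩

end Blocks

/-! ### Sufficiency: coding by component labels. -/

section Sufficiency

variable {X : Type*} [MetricSpace X]

/-- A family of sets of at most `N` members is separated by `N` binary digits. -/
theorem exists_digits {α : Type*} {T : Set α} {N : ℕ} (hT : #T ≤ N) :
    ∃ J : α → ℕ → Fin 2, ∀ c ∈ T, ∀ c' ∈ T, (∀ i < N, J c i = J c' i) → c = c' := by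
  classical
  have hfin : Finite T := Cardinal.lt_aleph0_iff_finite.1 (hT.trans_lt Cardinal.natCast_lt_aleph0)
  have := Fintype.ofFinite T
  have hcard : Fintype.card T ≤ N := by
    rw [Cardinal.mk_fintype] at hT
    exact_mod_cast hT
  obtain ⟨e⟩ : Nonempty (T ↪ Fin N) :=
    Function.Embedding.nonempty_of_card_le (by simpa using hcard)
  -- One-hot code: each member has its own position carrying the digit `1`.
  refine ⟨fun c i => if h : c ∈ T then (if (e ⟨c, h⟩ : ℕ) = i then 1 else 0) else 0,
    fun c hc c' hc' h => ?_⟩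
  have h1 := h (e ⟨c, hc⟩) (e ⟨c, hc⟩).2
  simp only [hc, hc', dif_pos, if_true] at h1
  by_cases h2 : (e ⟨c', hc'⟩ : ℕ) = e ⟨c, hc⟩
  · exact (congrArg Subtype.val (e.injective (Fin.ext h2))).symm
  · simp [h2] at h1

/-- The digits that tell the `s`-components inside one `t`-component apart; they vanish on the
`s`-component of the base point. -/
theorem exists_label (x₀ : X) {s t : ℝ} (hθ : bigTheta X s t < ℵ₀) :
    ∃ (n : ℕ) (l : X → ℕ → Fin 2), 0 < n ∧
      (∀ x y, component t x = component t y →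
        (component s x = component s y ↔ ∀ i < n, l x i = l y i)) ∧
      ∀ x, component s x = component s x₀ → ∀ i, l x i = 0 := by
  obtain ⟨n, hn⟩ := bigTheta_lt_aleph0_iff.1 hθ
  have hJ : ∀ C : Set X, ∃ J : Set X → ℕ → Fin 2, ∀ x, component t x = C →
      ∀ c ∈ component s '' C, ∀ c' ∈ component s '' C,
        (∀ i < n + 1, J c i = J c' i) → c = c' := by
    intro C
    by_cases hC : ∃ x, component t x = C
    · obtain ⟨x, rfl⟩ := hC
      obtain ⟨J, hJ⟩ := exists_digits (N := n + 1) ((hn x).trans (by push_cast; simp))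
      exact ⟨J, fun _ _ => hJ⟩
    · exact ⟨fun _ _ => 0, fun x hx => (hC ⟨x, hx⟩).elim⟩
  choose J hJ using hJ
  -- The extra digit keeps blocks nonempty. The subtracted term is constant on each `t`-component,
  -- so it preserves separation while zeroing the base point's label.
  refine ⟨n + 1, fun x i => J (component t x) (component s x) i -
    J (component t x) (component s x₀) i, n.succ_pos, fun x y hxy => ⟨fun h i _ => ?_, fun h => ?_⟩,
    fun x hx i => ?_⟩
  · simp only [hxy, h]
  · refine hJ _ x rfl _ ⟨x, mem_component_self t x, rfl⟩ _ ⟨y, component_eq_iff.1 hxy, rfl⟩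
      fun i hi => ?_
    have := h i hi
    simp only [← hxy] at this
    exact sub_left_injective this
  · simp [hx]

/-- The coding map: at all dyadic scales, components correspond to balls of the bi-cube. -/
theorem exists_coding (x₀ : X) (hθ : ∀ δ ε : ℝ, 0 < δ → δ ≤ ε → bigTheta X δ ε < ℵ₀) :
    ∃ (a : ℤ → ℤ) (φ : X → CantorBiCube), StrictMono a ∧
      ∀ k x y, dist (φ x) (φ y) < (2 : ℝ) ^ a k ↔
        component ((2 : ℝ) ^ k) x = component ((2 : ℝ) ^ k) y := by
  have hmono : ∀ {k l : ℤ}, k ≤ l → (2 : ℝ) ^ k ≤ (2 : ℝ) ^ l :=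
    fun h => zpow_le_zpow_right₀ (by norm_num) h
  have hlab := fun k : ℤ => exists_label x₀
    (hθ ((2 : ℝ) ^ k) ((2 : ℝ) ^ (k + 1)) (by positivity) (hmono (by omega)))
  choose n l hn hl hl₀ using hlab
  obtain ⟨a, ha⟩ := exists_forall_add_one_eq_add n
  have hamono : StrictMono a := strictMono_int_of_lt_succ fun k => by
    have := hn k
    rw [ha k]
    omega
  choose b hb hb' using exists_block hamono
  have hbig : ∀ x y : X, ∃ k : ℤ, component ((2 : ℝ) ^ k) x = component ((2 : ℝ) ^ k) y :=
    fun x y => (exists_lt_two_zpow (dist x y)).imp fun k hk =>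
      component_eq_iff.2 (mem_component_of_dist_le hk.le)
  have hbk : ∀ k i, a k ≤ i → k ≤ b i := fun k i hi =>
    Int.lt_add_one_iff.1 (hamono.lt_iff_lt.1 (hi.trans_lt (hb' i)))
  have hbeq : ∀ k (j : ℕ), j < n k → b (a k + j) = k := fun k j hj => by
    refine le_antisymm (Int.lt_add_one_iff.1 (hamono.lt_iff_lt.1 ((hb _).trans_lt ?_)))
      (hbk k _ (by omega))
    rw [ha k]
    omega
  -- Once `x` and `x₀` share a `2 ^ k`-component, all labels of `x` from level `k` on vanish.
  let φ : X → CantorBiCube := fun x => ⟨fun i => l (b i) x (i - a (b i)).toNat, by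
    obtain ⟨k, hk⟩ := hbig x x₀
    refine ⟨(a k).toNat, fun i hi => hl₀ _ x (component_eq_mono (hmono (hbk k i ?_)) hk) _⟩
    omega⟩
  refine ⟨a, φ, hamono, fun k x y => CantorBiCube.dist_lt_two_zpow_iff.trans ⟨fun h => ?_,
    fun h i hi => ?_⟩⟩
  · obtain ⟨K, hK⟩ := hbig x y
    rcases le_total K k with hKk | hkK
    · exact component_eq_mono (hmono hKk) hK
    -- Descend from a common large component: equal digits in block `K` give equality one level
    -- down.
    · induction K, hkK using Int.leInduction with
      | base => exact hK
      | succ K hkK ih =>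
        refine ih ((hl K x y hK).2 fun j hj => ?_)
        have hak := hamono.monotone hkK
        simpa [φ, hbeq K j hj] using h (a K + j) (by omega)
  · have hki := hbk k i hi
    refine (hl (b i) x y (component_eq_mono (hmono (by omega)) h)).1
      (component_eq_mono (hmono hki) h) _ ?_
    have h1 := hb i
    have h2 := hb' i
    rw [ha] at h2
    omega

theorem exists_biUniformlyEquivalent (hdim : BiUniformDimZero X)
    (hθ : ∀ δ ε : ℝ, 0 < δ → δ ≤ ε → bigTheta X δ ε < ℵ₀) :
    ∃ S : Set CantorBiCube, BiUniformlyEquivalent X S := by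
  rcases isEmpty_or_nonempty X with hX | ⟨⟨x₀⟩⟩
  · refine ⟨∅, Equiv.equivOfIsEmpty X _, ⟨?_, ?_⟩, ?_, ?_⟩
    · exact fun δ hδ => ⟨0, le_rfl, by simp [oscillation]⟩
    · exact fun ε hε => ⟨1, one_pos, by simp [oscillation]⟩
    · exact fun δ hδ => ⟨0, le_rfl, by simp [oscillation]⟩
    · exact fun ε hε => ⟨1, one_pos, by simp [oscillation]⟩
  obtain ⟨a, φ, ha, hφ⟩ := exists_coding x₀ hθ
  have hfwd : ∀ k x y, dist x y ≤ (2 : ℝ) ^ k → dist (φ x) (φ y) < (2 : ℝ) ^ a k :=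
    fun k x y h => (hφ k x y).2 (component_eq_iff.2 (mem_component_of_dist_le h))
  have hmicro : ∀ ε : ℝ, 0 < ε → ∃ δ : ℝ, 0 < δ ∧
      ∀ x y, dist (φ x) (φ y) ≤ δ → dist x y ≤ ε := by
    intro ε hε
    obtain ⟨δ, hδ, h⟩ := hdim.1 ε hε
    rw [mesh_components_le_ofReal_iff hε.le] at h
    obtain ⟨k, hk⟩ := exists_two_zpow_le hδ
    -- The `- 1` turns `≤` into the strict bound that `hφ` requires.
    refine ⟨(2 : ℝ) ^ (a k - 1), by positivity, fun x y hxy => h x y (component_mono hk x ?_)⟩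
    exact component_eq_iff.1 ((hφ k x y).1
      (hxy.trans_lt (zpow_lt_zpow_right₀ (by norm_num) (by omega))))
  have hinj : Function.Injective φ := fun x y hxy => by
    refine dist_le_zero.1 (le_of_forall_pos_le_add fun ε hε => ?_)
    obtain ⟨δ, hδ, h⟩ := hmicro ε hε
    simpa using h x y (by simpa [hxy] using hδ.le)
  let e := Equiv.ofInjective φ hinj
  have he : ∀ y y', dist (φ (e.symm y)) (φ (e.symm y')) = dist y y' := fun y y' => by
    rw [Subtype.dist_eq, Equiv.apply_ofInjective_symm hinj, Equiv.apply_ofInjective_symm hinj]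
  refine ⟨Set.range φ, e, ⟨fun δ _ => ?_, fun ε hε => ?_⟩, fun δ hδ => ?_, fun ε hε => ?_⟩
  · obtain ⟨k, hk⟩ := exists_lt_two_zpow δ
    refine ⟨(2 : ℝ) ^ a k, by positivity, (oscillation_le_ofReal_iff (by positivity)).2 ?_⟩
    exact fun x y hxy => (hfwd k x y (hxy.trans hk.le)).le
  · obtain ⟨m, hm⟩ := exists_two_zpow_le hε
    obtain ⟨k, hk⟩ := exists_le_of_strictMono ha m
    refine ⟨(2 : ℝ) ^ k, by positivity, (oscillation_le_ofReal_iff hε.le).2 ?_⟩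
    exact fun x y hxy => (hfwd k x y hxy).le.trans
      ((zpow_le_zpow_right₀ (by norm_num) hk).trans hm)
  · obtain ⟨m, hm⟩ := exists_lt_two_zpow δ
    obtain ⟨k, hk⟩ := exists_ge_of_strictMono ha m
    obtain ⟨ε, hε, h⟩ := hdim.2 ((2 : ℝ) ^ k) (by positivity)
    rw [mesh_components_le_ofReal_iff hε] at h
    refine ⟨ε, hε, (oscillation_le_ofReal_iff hε).2 fun y y' hy => h _ _ ?_⟩
    refine component_eq_iff.1 ((hφ k _ _).1 ?_)
    rw [he]
    exact hy.trans_lt (hm.trans_le (zpow_le_zpow_right₀ (by norm_num) hk))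
  · obtain ⟨δ, hδ, h⟩ := hmicro ε hε
    exact ⟨δ, hδ, (oscillation_le_ofReal_iff hε.le).2 fun y y' hy => h _ _ ((he y y').trans_le hy)⟩

end Sufficiency

end BiUniform

theorem mainTheorem4 (X : Type*) [MetricSpace X] :
    (∃ S : Set BiUniform.CantorBiCube, BiUniform.BiUniformlyEquivalent X S) ↔
      (BiUniform.BiUniformDimZero X ∧
        ∀ δ ε : ℝ, 0 < δ → δ ≤ ε → BiUniform.bigTheta X δ ε < ℵ₀) := by
  constructor
  · rintro ⟨S, f, hf, hg⟩
    exact ⟨BiUniform.biUniformDimZero_of_equiv hf hg, fun δ ε hδ hδε =>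
      BiUniform.bigTheta_lt_aleph0_of_equiv hf hg hδ (hδ.le.trans hδε)⟩
  · rintro ⟨hdim, hθ⟩
    exact BiUniform.exists_biUniformlyEquivalent hdim hθ
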